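/- Let $N\ge 1$ and $d\ge 0$ be integers and let $[x_k]=(x_0,\dots,x_N)$ denote sequences of $\mathbb R^d$-valued random variables. Such a sequence is ZMNG (zero-mean nonsingular Gaussian) if $x_0,\dots,x_N$ are jointly Gaussian with zero mean and the covariance matrix of $(x_0,\dots,x_N)$ is nonsingular. It is reciprocal if for all $k_1<k_2$ the subsequences $(x_k)_{k_1<k<k_2}$ and $(x_k)_{k<k_1\text{ or }k>k_2}$ are independent conditioned on $(x_{k_1},x_{k_2})$, and it is Markov if for every $k$ the subsequences $(x_i)_{i<k}$ and $(x_i)_{i>k}$ are independent conditioned on $x_k$. Let $c\in\{0,N\}$, let $G^B_{k,l}$ be real $d\times d$ matrices and let $G^B_0,\dots,G^B_N$ be nonsingular covariance (i.e. symmetric positive definite) $d\times d$ matrices. The backward $CM_c$ model with these parameters is $$x_k=G^B_{k,k+1}x_{k+1}+G^B_{k,c}x_c+e^B_k,\qquad k\in\{0,\dots,N-1\}\setminus\{c\},$$ where $[e^B_k]$ is a zero-mean white Gaussian sequence (jointly Gaussian, uncorrelated at different times) with $\operatorname{Cov}(e^B_k)=G^B_k$, together with a boundary condition: for $c=0$ either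 $$\text{(BC1)}\quad x_N=e^B_N,\quad x_0=G^B_{0,N}x_N+e^B_0,\qquad\text{or}\qquad \text{(BC2)}\quad x_0=e^B_0,\quad x_N=G^B_{N,0}x_0+e^B_N,$$ and for $c=N$ the condition $x_N=e^B_N$. Put $$A=(\mathcal G^B)'(G^B)^{-1}\mathcal G^B,\qquad G^B=\operatorname{diag}(G^B_0,\dots,G^B_N),$$ where $\mathcal G^B$ is the $(N+1)\times(N+1)$ block matrix with $d\times d$ blocks (block rows and columns numbered $0,\dots,N$), with diagonal blocks $I$, and whose off-diagonal blocks are zero except for the following ones. - For $c=0$ with (BC1): block $(0,N)$ is $-G^B_{0,N}$; and for $1\le k\le N-1$, block $(k,0)$ is $-G^B_{k,0}$ and block $(k,k+1)$ is $-G^B_{k,k+1}$. - For $c=0$ with (BC2): block $(N,0)$ is $-G^B_{N,0}$; and for $1\le k\le N-1$, block $(k,0)$ is $-G^B_{k,0}$ and block $(k,k+1)$ is $-G^B_{k,k+1}$. - For $c=N$: for $0\le k\le N-2$, block $(k,k+1)$ is $-G^B_{k,k+1}$ and block $(k,N)$ is $-G^B_{k,N}$; and block $(N-1,N)$ is $-2G^B_{N-1,N}$.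 Then in each of the three cases the model governs some sequence, and every sequence $[x_k]$ governed by it is ZMNG. Such a sequence is reciprocal if and only if $A$ is cyclic (block) tri-diagonal, i.e. all blocks $(k,l)$ of $A$ with $|k-l|>1$ vanish except possibly the corner blocks $(0,N)$ and $(N,0)$. Moreover, it is Markov if and only if $A$ is (block) tri-diagonal, i.e. all blocks $(k,l)$ of $A$ with $|k-l|>1$ vanish. -/

import Mathlib

open MeasureTheory ProbabilityTheory
open scoped Matrix

namespace BackwardCM

/-- A stochastic sequence `[x_k]`, `k = 0, 1, …, N`, with values in `ℝ^d`. -/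
abbrev Sequence (N d : ℕ) (Ω : Type*) := Fin (N + 1) → Ω → (Fin d → ℝ)

/-- A square matrix with `(N + 1) × (N + 1)` blocks of size `d × d`. The entry at `((k, i), (l, j))`
is the entry `(i, j)` of the block in block row `k` and block column `l`, where block rows and
columns are numbered `0, …, N`. -/
abbrev BlockMatrix (N d : ℕ) := Matrix (Fin (N + 1) × Fin d) (Fin (N + 1) × Fin d) ℝ

/-- The σ-algebra generated by the subsequence `{x_k, k ∈ S}`. -/
@[reducible]
def sigmaOf {N d : ℕ} {Ω : Type*} (x : Sequence N d Ω) (S : Set (Fin (N + 1))) : MeasurableSpace Ω :=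
  ⨆ k ∈ S, MeasurableSpace.comap (x k) inferInstance

section Sequences

variable {N d : ℕ} {Ω : Type*} [MeasurableSpace Ω]

/-- The covariance matrix of the whole sequence. -/
noncomputable def covMatrix (x : Sequence N d Ω) (P : Measure Ω) : BlockMatrix N d :=
  Matrix.of fun p q => covariance (fun ω => x p.1 ω p.2) (fun ω => x q.1 ω q.2) P

/-- Zero-mean nonsingular Gaussian (ZMNG) sequences: the variables are jointly Gaussian with zero
mean, and the covariance matrix of the whole sequence is nonsingular. -/
structure IsZMNG (x : Sequence N d Ω) (P : Measure Ω) : Prop where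
  gaussian : IsGaussianProcess x P
  mean_zero : ∀ k i, ∫ ω, x k ω i ∂P = 0
  nonsingular : (covMatrix x P).det ≠ 0

/-- Zero-mean white Gaussian sequences with covariances `G_0, …, G_N`: jointly Gaussian, zero-mean,
uncorrelated at different times, and `G_k` is the covariance matrix at time `k`. -/
structure IsWhiteGaussian (e : Sequence N d Ω) (G : Fin (N + 1) → Matrix (Fin d) (Fin d) ℝ)
    (P : Measure Ω) : Prop where
  gaussian : IsGaussianProcess e P
  mean_zero : ∀ k i, ∫ ω, e k ω i ∂P = 0
  cov_eq : ∀ k l i j,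
    covariance (fun ω => e k ω i) (fun ω => e l ω j) P = if k = l then G k i j else 0

/-- The subsequences `{x_k, k ∈ S}` and `{x_k, k ∈ T}` are independent conditioned on
`{x_k, k ∈ R}`: `P(s ∩ t | R) = P(s | R) P(t | R)` almost surely for all events `s`, `t` of the
two subsequences. -/
def CondIndepGiven (x : Sequence N d Ω) (P : Measure Ω) (R S T : Set (Fin (N + 1))) : Prop :=
  ∀ s t : Set Ω, MeasurableSet[sigmaOf x S] s → MeasurableSet[sigmaOf x T] t →
    P⟦s ∩ t | sigmaOf x R⟧ =ᵐ[P] P⟦s | sigmaOf x R⟧ * P⟦t | sigmaOf x R⟧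

/-- Reciprocal sequences: for all `k₁ < k₂` the subsequences inside and outside the interval
`[k₁, k₂]` are independent conditioned on the boundaries `x_{k₁}` and `x_{k₂}`. -/
def IsReciprocal (x : Sequence N d Ω) (P : Measure Ω) : Prop :=
  ∀ k₁ k₂ : Fin (N + 1), k₁ < k₂ →
    CondIndepGiven x P {k₁, k₂} {k | k₁ < k ∧ k < k₂} {k | k < k₁ ∨ k₂ < k}

/-- Markov sequences: for all `k` the subsequences before and after `k` are independent conditioned
on the state `x_k`. -/
def IsMarkov (x : Sequence N d Ω) (P : Measure Ω) : Prop :=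
  ∀ k : Fin (N + 1), CondIndepGiven x P {k} {i | i < k} {i | k < i}

end Sequences

/-- The three backward `CM_c` models: `c = 0` with the first boundary condition
`x_N = e_N`, `x_0 = G_{0,N} x_N + e_0`; `c = 0` with the second boundary condition
`x_0 = e_0`, `x_N = G_{N,0} x_0 + e_N`; and `c = N` (with `x_N = e_N`). -/
inductive Kind
  | firstBC1
  | firstBC2
  | last

/-- The conditioning time `c` of the model. -/
def Kind.c (N : ℕ) : Kind → Fin (N + 1)
  | .firstBC1 => 0
  | .firstBC2 => 0
  | .last => Fin.last N

section Model

variable {N d : ℕ}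

/-- The boundary condition of the model, at the level of realizations. The matrix `F k l` is the
coefficient `G_{k,l}`. -/
def Kind.Boundary (m : Kind) (F : Fin (N + 1) → Fin (N + 1) → Matrix (Fin d) (Fin d) ℝ)
    (x e : Fin (N + 1) → (Fin d → ℝ)) : Prop :=
  match m with
  | .firstBC1 =>
      x (Fin.last N) = e (Fin.last N) ∧ x 0 = F 0 (Fin.last N) *ᵥ x (Fin.last N) + e 0
  | .firstBC2 =>
      x 0 = e 0 ∧ x (Fin.last N) = F (Fin.last N) 0 *ᵥ x 0 + e (Fin.last N)
  | .last => x (Fin.last N) = e (Fin.last N)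

/-- The sequence `x` is governed by the backward `CM_c` model with coefficients `G_{k,l} = F k l`
and noise covariances `G_k = G k`: there is a zero-mean white Gaussian sequence `e` with covariances
`G_k` such that almost surely
`x_k = G_{k,k+1} x_{k+1} + G_{k,c} x_c + e_k` for `k ∈ [0, N) \ {c}`, and the boundary condition
holds. -/
def IsGovernedBy {Ω : Type*} [MeasurableSpace Ω] (m : Kind)
    (F : Fin (N + 1) → Fin (N + 1) → Matrix (Fin d) (Fin d) ℝ)
    (G : Fin (N + 1) → Matrix (Fin d) (Fin d) ℝ) (x : Sequence N d Ω) (P : Measure Ω) : Prop :=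
  ∃ e : Sequence N d Ω, IsWhiteGaussian e G P ∧
    ∀ᵐ ω ∂P,
      (∀ k : Fin N, k.castSucc ≠ m.c N →
        x k.castSucc ω = F k.castSucc k.succ *ᵥ x k.succ ω
          + F k.castSucc (m.c N) *ᵥ x (m.c N) ω + e k.castSucc ω) ∧
      m.Boundary F (fun k => x k ω) (fun k => e k ω)

/-- The blocks of the matrix `𝒢` of the model, `k` being the block row and `l` the block column. -/
def Kind.calGBlock (m : Kind) (F : Fin (N + 1) → Fin (N + 1) → Matrix (Fin d) (Fin d) ℝ)
    (k l : Fin (N + 1)) : Matrix (Fin d) (Fin d) ℝ :=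
  if k = l then 1
  else match m with
  | .firstBC1 =>
      if k = 0 then (if l = Fin.last N then -F 0 (Fin.last N) else 0)
      else if k = Fin.last N then 0
      else if l = 0 then -F k 0
      else if (l : ℕ) = k + 1 then -F k l
      else 0
  | .firstBC2 =>
      if k = 0 then 0
      else if k = Fin.last N then (if l = 0 then -F (Fin.last N) 0 else 0)
      else if l = 0 then -F k 0
      else if (l : ℕ) = k + 1 then -F k l
      else 0
  | .last =>
      if k = Fin.last N then 0
      else if l = Fin.last N then
        (if (l : ℕ) = k + 1 then -((2 : ℝ) • F k (Fin.last N)) else -F k (Fin.last N))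
      else if (l : ℕ) = k + 1 then -F k l
      else 0

/-- The matrix `𝒢` of the model. -/
def Kind.calG (m : Kind) (F : Fin (N + 1) → Fin (N + 1) → Matrix (Fin d) (Fin d) ℝ) :
    BlockMatrix N d :=
  Matrix.of fun p q => m.calGBlock F p.1 q.1 p.2 q.2

/-- The block diagonal matrix `diag(G_0, …, G_N)`. -/
def diagG (G : Fin (N + 1) → Matrix (Fin d) (Fin d) ℝ) : BlockMatrix N d :=
  Matrix.of fun p q => if p.1 = q.1 then G p.1 p.2 q.2 else 0

/-- The matrix `A = 𝒢' diag(G_0, …, G_N)⁻¹ 𝒢`. -/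
noncomputable def Kind.A (m : Kind) (F : Fin (N + 1) → Fin (N + 1) → Matrix (Fin d) (Fin d) ℝ)
    (G : Fin (N + 1) → Matrix (Fin d) (Fin d) ℝ) : BlockMatrix N d :=
  (m.calG F)ᵀ * (diagG G)⁻¹ * m.calG F

/-- (Block) tri-diagonal matrices: the blocks `(k, l)` with `|k - l| > 1` vanish. -/
def IsTridiagonal (A : BlockMatrix N d) : Prop :=
  ∀ k l : Fin (N + 1), (k : ℕ) + 1 < l → ∀ i j, A (k, i) (l, j) = 0 ∧ A (l, j) (k, i) = 0

/-- Cyclic (block) tri-diagonal matrices: the blocks `(k, l)` with `|k - l| > 1` vanish, except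
possibly the corner blocks `(0, N)` and `(N, 0)`. -/
def IsCyclicTridiagonal (A : BlockMatrix N d) : Prop :=
  ∀ k l : Fin (N + 1), (k : ℕ) + 1 < l → ¬ (k = 0 ∧ l = Fin.last N) →
    ∀ i j, A (k, i) (l, j) = 0 ∧ A (l, j) (k, i) = 0

end Model

end BackwardCM

namespace BackwardCM

/-! ### Conditional independence expressed through conditional expectations. -/

section CondExp

variable {Ω : Type*} {m₁ m₂ m₃ m0 : MeasurableSpace Ω} {P : Measure Ω}

/-! Stacking the model equations gives a linear system 𝒢x = e. Backward substitution shows that 𝒢 is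
invertible (`isUnit_det_calG`), so x = 𝒢⁻¹e is centred Gaussian with covariance 𝒢⁻¹ diag(G) (𝒢⁻¹)'.
The inverse of this covariance is A (`IsGovernedBy.law`): A is the precision matrix of x. The same
inversion constructs a governed sequence from any white noise.

Everything then rests on `condIndep_iff_precision_eq_zero`: for a partition R, S, T of the indices,
X_S and X_T are independent given X_R iff A_ST = 0. No conditional Gaussian laws are needed. The
vector W = AX satisfies cov(W_i, X_j) = δ_ij, so W_S is independent of X outside S. If A_ST = 0,
then W_S involves only X_S and X_R, and X_S is recovered from W_S and X_R because A_SS is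
invertible; as W_S is independent of (X_R, X_T), conditional independence follows. Conversely, for t
in T, conditioning W_t on (X_R, X_S) shows that Σ_{s∈S} A_ts X_s is almost surely a function of X_R.
It is then uncorrelated with each W_s, and that covariance is A_ts.

Reciprocity and the Markov property are families of such partitions, and it remains to see which
blocks they force to vanish. -/

lemma setIntegral_eq_zero_of_sup (h₁ : m₁ ≤ m0) (h₂ : m₂ ≤ m0) {h : Ω → ℝ} (hh : Integrable h P)
    (H : ∀ s t, MeasurableSet[m₁] s → MeasurableSet[m₂] t → ∫ ω in s ∩ t, h ω ∂P = 0)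
    {u : Set Ω} (hu : MeasurableSet[m₁ ⊔ m₂] u) : ∫ ω in u, h ω ∂P = 0 := by
  have hle : m₁ ⊔ m₂ ≤ m0 := sup_le h₁ h₂
  have hgen : m₁ ⊔ m₂ = MeasurableSpace.generateFrom
      (Set.image2 (· ∩ ·) {s | MeasurableSet[m₁] s} {t | MeasurableSet[m₂] t}) := by
    apply le_antisymm
    · refine sup_le (fun s hs => ?_) (fun t ht => ?_)
      · exact MeasurableSpace.measurableSet_generateFrom
          ⟨s, hs, Set.univ, @MeasurableSet.univ _ m₂, by simp⟩
      · exact MeasurableSpace.measurableSet_generateFrom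
          ⟨Set.univ, @MeasurableSet.univ _ m₁, t, ht, by simp⟩
    · refine MeasurableSpace.generateFrom_le ?_
      rintro _ ⟨s, hs, t, ht, rfl⟩
      exact @MeasurableSet.inter _ (m₁ ⊔ m₂) _ _
        ((le_sup_left : m₁ ≤ m₁ ⊔ m₂) _ hs) ((le_sup_right : m₂ ≤ m₁ ⊔ m₂) _ ht)
  have hpi : IsPiSystem
      (Set.image2 (· ∩ ·) {s | MeasurableSet[m₁] s} {t | MeasurableSet[m₂] t}) := by
    rintro _ ⟨s, hs, t, ht, rfl⟩ _ ⟨s', hs', t', ht', rfl⟩ -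
    exact ⟨s ∩ s', @MeasurableSet.inter _ m₁ _ _ hs hs', t ∩ t',
      @MeasurableSet.inter _ m₂ _ _ ht ht', Set.inter_inter_inter_comm _ _ _ _⟩
  have huniv : ∫ ω, h ω ∂P = 0 := by
    simpa using H Set.univ Set.univ (@MeasurableSet.univ _ m₁) (@MeasurableSet.univ _ m₂)
  induction u, hu using MeasurableSpace.induction_on_inter hgen hpi with
  | empty => simp
  | basic u hu =>
    obtain ⟨s, hs, t, ht, rfl⟩ := hu
    exact H s t hs ht
  | compl u hu ih =>
    rw [setIntegral_compl (hle _ hu) hh, ih, huniv, sub_zero]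
  | iUnion f hd hf ih =>
    rw [integral_iUnion (fun i => hle _ (hf i)) hd hh.integrableOn]
    simp [ih]

/-- The intersections s ∩ t form a π-system generating `m₁ ⊔ m₂`, so the defining property of
conditional expectation need only be tested on them. -/
lemma condExp_sup_eq [IsFiniteMeasure P] (h₁ : m₁ ≤ m0) (h₂ : m₂ ≤ m0) {f g : Ω → ℝ}
    (hf : Integrable f P) (hg : Integrable g P) (hgm : StronglyMeasurable[m₁ ⊔ m₂] g)
    (H : ∀ s t, MeasurableSet[m₁] s → MeasurableSet[m₂] t →
      ∫ ω in s ∩ t, g ω ∂P = ∫ ω in s ∩ t, f ω ∂P) :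
    P[f | m₁ ⊔ m₂] =ᵐ[P] g := by
  refine (ae_eq_condExp_of_forall_setIntegral_eq (sup_le h₁ h₂) hf
    (fun _ _ _ => hg.integrableOn) (fun u hu _ => ?_) hgm.aestronglyMeasurable).symm
  rw [← sub_eq_zero, ← integral_sub hg.integrableOn hf.integrableOn]
  refine setIntegral_eq_zero_of_sup (h := fun ω => g ω - f ω) h₁ h₂ (hg.sub hf)
    (fun s t hs ht => ?_) hu
  rw [integral_sub hg.integrableOn hf.integrableOn, H s t hs ht, sub_self]

lemma setIntegral_eq_mul_of_indep [IsProbabilityMeasure P] (h₁ : m₁ ≤ m0) (h₂ : m₂ ≤ m0)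
    (hind : Indep m₁ m₂ P) {f : Ω → ℝ} (hf : Integrable f P) (hfm : StronglyMeasurable[m₂] f)
    {s : Set Ω} (hs : MeasurableSet[m₁] s) : ∫ ω in s, f ω ∂P = P.real s * ∫ ω, f ω ∂P := by
  rw [← setIntegral_condExp h₁ hf hs,
    setIntegral_congr_ae (h₁ _ hs) ((condExp_indep_eq h₂ h₁ hfm hind.symm).mono fun _ h _ => h)]
  simp

/-- If `m₁` is independent of `m₂ ⊔ m₃`, then `m₁ ⊔ m₂` and `m₃` are independent
conditioned on `m₂`. -/
lemma condIndep_of_indep_sup [IsProbabilityMeasure P] (h₁ : m₁ ≤ m0) (h₂ : m₂ ≤ m0)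
    (h₃ : m₃ ≤ m0) (hind : Indep m₁ (m₂ ⊔ m₃) P) {s t : Set Ω}
    (hs : MeasurableSet[m₁ ⊔ m₂] s) (ht : MeasurableSet[m₃] t) :
    P⟦s ∩ t | m₂⟧ =ᵐ[P] P⟦s | m₂⟧ * P⟦t | m₂⟧ := by
  have hle : m₁ ⊔ m₂ ≤ m0 := sup_le h₁ h₂
  have hle' : m₂ ⊔ m₃ ≤ m0 := sup_le h₂ h₃
  have hs0 := hle _ hs
  have ht0 := h₃ _ ht
  have hti : Integrable (t.indicator fun _ => (1 : ℝ)) P := (integrable_const 1).indicator ht0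
  have hsi : Integrable (s.indicator fun _ => (1 : ℝ)) P := (integrable_const 1).indicator hs0
  have hmul : ∀ k : Ω → ℝ, ((s.indicator fun _ => (1 : ℝ)) * k) = s.indicator k := fun k => by
    ext ω; by_cases hω : ω ∈ s <;> simp [hω]
  have hst : ((s ∩ t).indicator fun _ => (1 : ℝ)) =
      (s.indicator fun _ => (1 : ℝ)) * (t.indicator fun _ => (1 : ℝ)) := by
    rw [hmul, Set.indicator_indicator]
  have htm : StronglyMeasurable[m₂ ⊔ m₃] (t.indicator fun _ => (1 : ℝ)) :=
    stronglyMeasurable_const.indicator ((le_sup_right : m₃ ≤ m₂ ⊔ m₃) _ ht)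
  -- On u ∩ v, independence extracts the factor P(u) from both integrals; what remains is the
  -- defining property of `P⟦t | m₂⟧` on v.
  have key : P⟦t | m₁ ⊔ m₂⟧ =ᵐ[P] P⟦t | m₂⟧ := by
    refine condExp_sup_eq h₁ h₂ hti integrable_condExp
      (stronglyMeasurable_condExp.mono le_sup_right) fun u v hu hv => ?_
    have hv0 := h₂ _ hv
    have hv' : MeasurableSet[m₂ ⊔ m₃] v := (le_sup_left : m₂ ≤ m₂ ⊔ m₃) _ hv
    rw [← setIntegral_indicator hv0, ← setIntegral_indicator hv0,
      setIntegral_eq_mul_of_indep h₁ hle' hind (integrable_condExp.indicator hv0)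
        ((stronglyMeasurable_condExp.mono le_sup_left).indicator hv') hu,
      setIntegral_eq_mul_of_indep h₁ hle' hind (hti.indicator hv0) (htm.indicator hv') hu,
      integral_indicator hv0, integral_indicator hv0, setIntegral_condExp h₂ hti hv]
  calc P⟦s ∩ t | m₂⟧ =ᵐ[P] P[P⟦s ∩ t | m₁ ⊔ m₂⟧ | m₂] :=
        (condExp_condExp_of_le le_sup_right hle).symm
    _ =ᵐ[P] P[(s.indicator fun _ => (1 : ℝ)) * P⟦t | m₂⟧ | m₂] := by
        refine condExp_congr_ae ?_
        rw [hst]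
        refine (condExp_mul_of_stronglyMeasurable_left (stronglyMeasurable_const.indicator hs)
          (by rw [hmul]; exact hti.indicator hs0) hti).trans ?_
        filter_upwards [key] with ω hω
        simp [hω]
    _ =ᵐ[P] P⟦s | m₂⟧ * P⟦t | m₂⟧ :=
        condExp_mul_of_stronglyMeasurable_right stronglyMeasurable_condExp
          (by rw [hmul]; exact integrable_condExp.indicator hs0) hsi

/-- If `m₁` and `m₃` are independent conditioned on `m₂`, then for `m₃`-measurable functions
conditioning on `m₂ ⊔ m₁` is the same as conditioning on `m₂`. -/
lemma condExp_sup_eq_of_condIndep [IsProbabilityMeasure P] (h₁ : m₁ ≤ m0) (h₂ : m₂ ≤ m0)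
    (h₃ : m₃ ≤ m0)
    (H : ∀ s t : Set Ω, MeasurableSet[m₁] s → MeasurableSet[m₃] t →
      P⟦s ∩ t | m₂⟧ =ᵐ[P] P⟦s | m₂⟧ * P⟦t | m₂⟧)
    {f : Ω → ℝ} (hf : Integrable f P) (hfm : StronglyMeasurable[m₃] f) :
    P[f | m₂ ⊔ m₁] =ᵐ[P] P[f | m₂] := by
  refine condExp_sup_eq h₂ h₁ hf integrable_condExp
      (stronglyMeasurable_condExp.mono le_sup_left) fun r s hr hs => ?_
  have hr0 := h₂ _ hr
  have hs0 := h₁ _ hs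
  set q := P⟦s | m₂⟧ with hq
  have hqm : StronglyMeasurable[m₂] q := stronglyMeasurable_condExp
  have hsi : Integrable (s.indicator fun _ => (1 : ℝ)) P := (integrable_const 1).indicator hs0
  -- Boundedness of q keeps q * k integrable when k is merely integrable.
  have hqb : ∀ᵐ ω ∂P, ‖q ω‖ ≤ 1 := by
    have := ae_bdd_abs_condExp_of_ae_bdd_abs (m := m₂) (μ := P) (R := 1)
      (f := s.indicator fun _ => (1 : ℝ)) (Filter.Eventually.of_forall fun ω => by
        by_cases hω : ω ∈ s <;> simp [hω])
    filter_upwards [this] with ω hω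
    simpa using hω
  have hqi : ∀ {k : Ω → ℝ}, Integrable k P → Integrable (q * k) P := fun hk =>
    hk.bdd_mul (hqm.mono h₂).aestronglyMeasurable hqb
  have hmul : ∀ (u : Set Ω) (k : Ω → ℝ), ((u.indicator fun _ => (1 : ℝ)) * k) = u.indicator k :=
    fun u k => by ext ω; by_cases hω : ω ∈ u <;> simp [hω]
  have e1 : ∫ ω in r ∩ s, (P[f | m₂]) ω ∂P = ∫ ω in r, (q * P[f | m₂]) ω ∂P := by
    rw [← setIntegral_indicator hs0, ← hmul, ← setIntegral_condExp h₂
      (by rw [hmul]; exact integrable_condExp.indicator hs0) hr]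
    refine setIntegral_congr_ae hr0 ?_
    filter_upwards [condExp_mul_of_stronglyMeasurable_right (m := m₂) (μ := P)
      (f := s.indicator fun _ => (1 : ℝ)) (g := P[f | m₂]) stronglyMeasurable_condExp
      (by rw [hmul]; exact integrable_condExp.indicator hs0) hsi] with ω hω _ using hω
  have e2 : ∀ {k : Ω → ℝ}, Integrable k P →
      ∫ ω in r, (q * P[k | m₂]) ω ∂P = ∫ ω in r, (q * k) ω ∂P := fun {k} hk => by
    rw [← setIntegral_condExp h₂ (hqi hk) hr]
    refine setIntegral_congr_ae hr0 ?_
    filter_upwards [condExp_mul_of_stronglyMeasurable_left (m := m₂) (μ := P) hqm (hqi hk) hk]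
      with ω hω _ using hω.symm
  -- The hypothesis says that 1_r (1_s - P(s | m₂)) integrates to zero over every event of `m₃`.
  -- Hence its conditional expectation given `m₃` is zero, and pulling out f yields E[g f] = 0
  -- without approximating f by simple functions.
  set g : Ω → ℝ := r.indicator ((s.indicator fun _ => (1 : ℝ)) - q) with hg
  have hgi : Integrable g P := (hsi.sub integrable_condExp).indicator hr0
  have hgf : g * f = r.indicator (s.indicator f - q * f) := by
    ext ω
    by_cases hω : ω ∈ r <;> by_cases hω' : ω ∈ s <;> simp [hg, hω, hω', sub_mul]
  have hgfi : Integrable (g * f) P := by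
    rw [hgf]
    exact ((hf.indicator hs0).sub (hqi hf)).indicator hr0
  have hg0 : P[g | m₃] =ᵐ[P] 0 := by
    refine (ae_eq_condExp_of_forall_setIntegral_eq h₃ hgi
      (fun _ _ _ => integrableOn_zero) (fun t ht _ => ?_)
      stronglyMeasurable_zero.aestronglyMeasurable).symm
    have ht0 := h₃ _ ht
    have hti : Integrable (t.indicator fun _ => (1 : ℝ)) P := (integrable_const 1).indicator ht0
    have hsti : Integrable ((s ∩ t).indicator fun _ => (1 : ℝ)) P :=
      (integrable_const 1).indicator (hs0.inter ht0)
    have : t.indicator g = r.indicator (((s ∩ t).indicator fun _ => (1 : ℝ)) -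
        q * t.indicator fun _ => (1 : ℝ)) := by
      ext ω
      by_cases hω : ω ∈ r <;> by_cases hω' : ω ∈ t <;> by_cases hω'' : ω ∈ s <;>
        simp [hg, hω, hω', hω'']
    rw [← integral_indicator (f := g) ht0, this, integral_indicator hr0]
    simp only [Pi.sub_apply, integral_zero]
    rw [integral_sub hsti.integrableOn (hqi hti).integrableOn, ← e2 hti,
      ← setIntegral_condExp h₂ hsti hr, eq_comm, sub_eq_zero]
    exact setIntegral_congr_ae hr0 ((H s t hs ht).mono fun _ h _ => h)
  have e3 : ∫ ω, (g * f) ω ∂P = 0 := by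
    rw [← integral_condExp h₃]
    refine integral_eq_zero_of_ae ?_
    filter_upwards [condExp_mul_of_stronglyMeasurable_right hfm hgfi hgi, hg0] with ω h h'
    rw [h, Pi.mul_apply, h']
    simp
  rw [hgf, integral_indicator hr0] at e3
  simp only [Pi.sub_apply] at e3
  rw [integral_sub (hf.indicator hs0).integrableOn (hqi hf).integrableOn, sub_eq_zero,
    setIntegral_indicator hs0] at e3
  rw [e1, e2 hf, e3]

end CondExp

/-! ### Gaussian vectors: zeros of the precision matrix and conditional independence. -/

section Gaussian

variable {Ω ι : Type*}

/-- The σ-algebra generated by the real random variables `X i`, `i ∈ S`. -/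
@[reducible]
def genBy (X : ι → Ω → ℝ) (S : Set ι) : MeasurableSpace Ω :=
  ⨆ i ∈ S, MeasurableSpace.comap (X i) inferInstance

lemma measurable_genBy (X : ι → Ω → ℝ) {S : Set ι} {i : ι} (hi : i ∈ S) :
    Measurable[genBy X S] (X i) :=
  measurable_iff_comap_le.2 (le_iSup₂_of_le i hi le_rfl)

lemma genBy_le {m : MeasurableSpace Ω} {X : ι → Ω → ℝ} {S : Set ι}
    (h : ∀ i ∈ S, Measurable[m] (X i)) : genBy X S ≤ m :=
  iSup₂_le fun i hi => measurable_iff_comap_le.1 (h i hi)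

lemma comap_restrict_eq_genBy (X : ι → Ω → ℝ) (S : Set ι) :
    MeasurableSpace.comap (fun ω (i : S) => X i ω) inferInstance = genBy X S := by
  simp only [MeasurableSpace.pi, MeasurableSpace.comap_iSup, MeasurableSpace.comap_comp, genBy,
    iSup_subtype]
  rfl

variable {m0 : MeasurableSpace Ω} {P : Measure Ω} [Fintype ι]

omit [Fintype ι] in
lemma memLp_two_of_hasGaussianLaw {X : ι → Ω → ℝ} (hG : HasGaussianLaw (fun ω i => X i ω) P)
    (i : ι) : MemLp (X i) 2 P :=
  (hG.eval i).memLp_two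

lemma memLp_two_mulVec {κ : Type*} {X : ι → Ω → ℝ} (hX : ∀ i, MemLp (X i) 2 P)
    (B : Matrix κ ι ℝ) (i : κ) : MemLp (fun ω => (B *ᵥ fun j => X j ω) i) 2 P :=
  memLp_finsetSum _ fun j _ => (hX j).const_mul (B i j)

lemma covariance_mulVec_left [IsFiniteMeasure P] {κ : Type*} {X : ι → Ω → ℝ} {Y : Ω → ℝ}
    (hX : ∀ i, MemLp (X i) 2 P) (hY : MemLp Y 2 P) (B : Matrix κ ι ℝ) (i : κ) :
    cov[fun ω => (B *ᵥ fun j => X j ω) i, Y; P] = ∑ j, B i j * cov[X j, Y; P] := by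
  simp only [Matrix.mulVec, dotProduct]
  rw [covariance_fun_sum_left (fun j => (hX j).const_mul (B i j)) hY]
  simp [covariance_const_mul_left]

lemma covariance_mulVec_mulVec [IsFiniteMeasure P] {κ : Type*} {X : ι → Ω → ℝ}
    (hX : ∀ i, MemLp (X i) 2 P) (B : Matrix κ ι ℝ) (i j : κ) :
    cov[fun ω => (B *ᵥ fun k => X k ω) i, fun ω => (B *ᵥ fun k => X k ω) j; P] =
      (B * Matrix.of (fun k l => cov[X k, X l; P]) * Bᵀ) i j := by
  rw [covariance_mulVec_left hX (memLp_two_mulVec hX B j), Matrix.mul_assoc, Matrix.mul_apply]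
  refine Finset.sum_congr rfl fun k _ => ?_
  rw [covariance_comm, covariance_mulVec_left hX (hX k), Matrix.mul_apply]
  congr 1
  refine Finset.sum_congr rfl fun l _ => ?_
  rw [covariance_comm, Matrix.of_apply, Matrix.transpose_apply, mul_comm]

lemma integral_mulVec_eq_zero {κ : Type*} {X : ι → Ω → ℝ} (hX : ∀ i, Integrable (X i) P)
    (h0 : ∀ i, ∫ ω, X i ω ∂P = 0) (B : Matrix κ ι ℝ) (i : κ) :
    ∫ ω, (B *ᵥ fun j => X j ω) i ∂P = 0 := by
  simp only [Matrix.mulVec, dotProduct]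
  rw [integral_finsetSum _ fun j _ => (hX j).const_mul (B i j)]
  simp [integral_const_mul, h0]

variable [DecidableEq ι] {X : ι → Ω → ℝ} {A : Matrix ι ι ℝ}

/-- The biorthogonality of AX and X, which is AC = 1 read entrywise. -/
lemma covariance_precision_mulVec [IsFiniteMeasure P] (hX : ∀ i, MemLp (X i) 2 P)
    (hA : A * Matrix.of (fun i j => cov[X i, X j; P]) = 1) (i j : ι) :
    cov[fun ω => (A *ᵥ fun k => X k ω) i, X j; P] = if i = j then 1 else 0 := by
  rw [covariance_mulVec_left hX (hX j), ← Matrix.one_apply, ← hA, Matrix.mul_apply]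
  rfl

/-- The components in `S` of the precision matrix times a Gaussian vector are independent of the
components of the vector outside `S`. -/
lemma indep_precision_mulVec (hG : HasGaussianLaw (fun ω i => X i ω) P)
    (hA : A * Matrix.of (fun i j => cov[X i, X j; P]) = 1) (S : Set ι) :
    Indep (genBy (fun i ω => (A *ᵥ fun k => X k ω) i) S) (genBy X Sᶜ) P := by
  classical
  have := hG.isProbabilityMeasure
  rw [← comap_restrict_eq_genBy, ← comap_restrict_eq_genBy]
  let L₁ : (ι → ℝ) →L[ℝ] (S → ℝ) := LinearMap.toContinuousLinearMap
    ((LinearMap.funLeft ℝ ℝ Subtype.val).comp A.mulVecLin)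
  let L₂ : (ι → ℝ) →L[ℝ] ((Sᶜ : Set ι) → ℝ) := LinearMap.toContinuousLinearMap
    (LinearMap.funLeft ℝ ℝ Subtype.val)
  have hL : HasGaussianLaw (fun ω =>
      ((fun i : S => (A *ᵥ fun k => X k ω) i), (fun j : (Sᶜ : Set ι) => X j ω))) P :=
    hG.map (L₁.prod L₂)
  exact hL.indepFun_of_covariance_eval
    (X := fun (i : S) ω => (A *ᵥ fun k => X k ω) i) (Y := fun (j : (Sᶜ : Set ι)) ω => X j ω)
    fun i j => by
      rw [covariance_precision_mulVec (memLp_two_of_hasGaussianLaw hG) hA, if_neg]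
      rintro h
      exact j.2 (h ▸ i.2)

omit [DecidableEq ι] in
lemma measurable_mulVec {m : MeasurableSpace Ω} {κ : Type*} (hX : ∀ i, Measurable[m] (X i))
    (B : Matrix κ ι ℝ) (i : κ) : Measurable[m] fun ω => (B *ᵥ fun j => X j ω) i :=
  Finset.measurable_fun_sum _ fun j _ => (hX j).const_mul (B i j)

/-- With A_ST = 0, the rows in S read W_S = A_SS X_S + A_SR X_R. A principal submatrix of a positive
definite matrix is invertible, so this can be solved for X_S. -/
lemma genBy_le_of_precision_eq_zero (hA : A.PosDef) {R S T : Set ι}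
    (hcov : R ∪ S ∪ T = Set.univ) (hz : ∀ i ∈ S, ∀ j ∈ T, A i j = 0) :
    genBy X S ≤ genBy (fun i ω => (A *ᵥ fun k => X k ω) i) S ⊔ genBy X R := by
  classical
  set W : ι → Ω → ℝ := fun i ω => (A *ᵥ fun k => X k ω) i with hW
  let m : MeasurableSpace Ω := genBy W S ⊔ genBy X R
  let M : Matrix S S ℝ := A.submatrix Subtype.val Subtype.val
  have hM : IsUnit M := (hA.submatrix Subtype.val_injective).isUnit
  have hY : ∀ i : S, Measurable[m] fun ω => (M *ᵥ fun j : S => X j ω) i := fun i => by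
    have e : (fun ω => (M *ᵥ fun j : S => X j ω) i) =
        fun ω => W i ω - ∑ j : {j // j ∉ S}, A i j * X j ω := by
      ext ω
      rw [eq_sub_iff_add_eq]
      exact Fintype.sum_subtype_add_sum_subtype (· ∈ S) fun j => A i j * X j ω
    rw [e]
    have hWm : Measurable[m] (W i) :=
      (measurable_genBy W i.2).mono le_sup_left le_rfl
    refine hWm.sub (Finset.measurable_fun_sum _ fun j _ => ?_)
    have hj : (j : ι) ∈ R ∪ S ∪ T := hcov ▸ Set.mem_univ _
    rcases hj with (hj | hj) | hj
    · exact ((measurable_genBy X hj).mono (le_sup_right : _ ≤ m) le_rfl).const_mul _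
    · exact absurd hj j.2
    · simp only [hz i i.2 j hj, zero_mul]
      exact measurable_const
  refine genBy_le fun i hi => ?_
  have e : X i = fun ω => (M⁻¹ *ᵥ fun k => (M *ᵥ fun j : S => X j ω) k) ⟨i, hi⟩ := by
    ext ω
    change _ = (M⁻¹ *ᵥ (M *ᵥ fun j : S => X j ω)) ⟨i, hi⟩
    rw [Matrix.mulVec_mulVec, Matrix.nonsing_inv_mul _ ((Matrix.isUnit_iff_isUnit_det _).1 hM),
      Matrix.one_mulVec]
  rw [e]
  exact measurable_mulVec (X := fun k ω => (M *ᵥ fun j : S => X j ω) k) hY _ _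

/-- Two blocks of components of a centered Gaussian vector are independent conditioned on the
remaining components if and only if the corresponding block of the precision matrix vanishes. -/
theorem condIndep_iff_precision_eq_zero (hX : ∀ i, Measurable (X i))
    (hG : HasGaussianLaw (fun ω i => X i ω) P) (h0 : ∀ i, ∫ ω, X i ω ∂P = 0)
    (hC : A * Matrix.of (fun i j => cov[X i, X j; P]) = 1) (hA : A.PosDef) {R S T : Set ι}
    (hcov : R ∪ S ∪ T = Set.univ) (hRS : Disjoint R S) (hRT : Disjoint R T)
    (hST : Disjoint S T) :
    (∀ s t : Set Ω, MeasurableSet[genBy X S] s → MeasurableSet[genBy X T] t →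
      P⟦s ∩ t | genBy X R⟧ =ᵐ[P] P⟦s | genBy X R⟧ * P⟦t | genBy X R⟧) ↔
    ∀ i ∈ S, ∀ j ∈ T, A i j = 0 := by
  classical
  have := hG.isProbabilityMeasure
  have hle : ∀ U, genBy X U ≤ m0 := fun U => genBy_le fun i _ => hX i
  have hL2 := memLp_two_of_hasGaussianLaw hG
  have hint : ∀ i, Integrable (X i) P := fun i => (hL2 i).integrable one_le_two
  set W : ι → Ω → ℝ := fun i ω => (A *ᵥ fun k => X k ω) i with hW
  have hWm : ∀ i, Measurable (W i) := measurable_mulVec hX A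
  have hleW : ∀ U, genBy W U ≤ m0 := fun U => genBy_le fun i _ => hWm i
  have hsup : ∀ U V : Set ι, genBy X U ⊔ genBy X V = genBy X (U ∪ V) :=
    fun U V => iSup_union.symm
  constructor
  · intro H s hs t ht
    -- `Z U` is the contribution of the indices in U to W_t, so that W_t = Z R + Z S + Z T.
    let Z : Set ι → Ω → ℝ := fun U ω => ∑ j, if j ∈ U then A t j * X j ω else 0
    have hZm : ∀ U V, U ⊆ V → StronglyMeasurable[genBy X V] (Z U) := fun U V hUV => by
      refine Measurable.stronglyMeasurable (Finset.measurable_fun_sum _ fun j _ => ?_)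
      by_cases hj : j ∈ U
      · simpa [hj] using (measurable_genBy X (hUV hj)).const_mul (A t j)
      · simp [hj]
    have hZ2 : ∀ U, MemLp (Z U) 2 P := fun U => memLp_finsetSum _ fun j _ => by
      by_cases hj : j ∈ U
      · simpa [hj] using (hL2 j).const_mul (A t j)
      · simp [hj]
    have hZi : ∀ U, Integrable (Z U) P := fun U => (hZ2 U).integrable one_le_two
    have hsum : W t = Z R + Z S + Z T := by
      ext ω
      simp only [hW, Z, Matrix.mulVec, dotProduct, Pi.add_apply, ← Finset.sum_add_distrib]
      refine Finset.sum_congr rfl fun j _ => ?_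
      have hj : j ∈ R ∪ S ∪ T := hcov ▸ Set.mem_univ _
      rcases hj with (hj | hj) | hj
      · simp [hj, Set.disjoint_left.1 hRS hj, Set.disjoint_left.1 hRT hj]
      · simp [hj, Set.disjoint_right.1 hRS hj, Set.disjoint_left.1 hST hj]
      · simp [hj, Set.disjoint_right.1 hRT hj, Set.disjoint_right.1 hST hj]
    have hRSle : genBy X R ⊔ genBy X S ≤ m0 := sup_le (hle R) (hle S)
    have hind : ∀ U V : Set ι, Disjoint U V → Indep (genBy W U) (genBy X V) P := fun U V hUV =>
      indep_of_indep_of_le_right (indep_precision_mulVec hG hC U)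
        (genBy_le fun i hi => measurable_genBy X (Set.disjoint_right.1 hUV hi))
    -- W_t is centred and independent of (X_R, X_S), since t lies in neither set.
    have hWt : P[W t | genBy X R ⊔ genBy X S] =ᵐ[P] 0 := by
      have hm : StronglyMeasurable[genBy W T] (W t) :=
        (measurable_genBy W ht).stronglyMeasurable
      refine (condExp_indep_eq (hleW T) hRSle hm ?_).trans ?_
      · rw [hsup]
        exact hind _ _ (Disjoint.union_right hRT.symm hST.symm)
      · rw [integral_mulVec_eq_zero hint h0]
        rfl
    have hZT : P[Z T | genBy X R ⊔ genBy X S] =ᵐ[P] P[Z T | genBy X R] :=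
      condExp_sup_eq_of_condIndep (hle S) (hle R) (hle T) H (hZi T) (hZm T T subset_rfl)
    have hZRS : P[Z R + Z S | genBy X R ⊔ genBy X S] = Z R + Z S := by
      refine condExp_of_stronglyMeasurable hRSle ?_ ((hZi R).add (hZi S))
      rw [hsup]
      exact (hZm R _ Set.subset_union_left).add (hZm S _ Set.subset_union_right)
    set g : Ω → ℝ := - (Z R + P[Z T | genBy X R]) with hg
    have hgm : StronglyMeasurable[genBy X R] g :=
      ((hZm R R subset_rfl).add stronglyMeasurable_condExp).neg
    have hgi : Integrable g P := ((hZi R).add integrable_condExp).neg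
    -- Conditioning the decomposition of W_t on (X_R, X_S) gives 0 = Z R + Z S + E[Z T | X_R].
    have hSg : Z S =ᵐ[P] g := by
      have := condExp_add ((hZi R).add (hZi S)) (hZi T) (genBy X R ⊔ genBy X S)
      rw [← hsum, hZRS] at this
      filter_upwards [this, hWt, hZT] with ω h1 h2 h3
      simp only [Pi.add_apply, Pi.zero_apply, hg, Pi.neg_apply] at *
      linarith
    have hWs0 : ∫ ω, W s ω ∂P = 0 := integral_mulVec_eq_zero hint h0 A s
    have hcov0 : cov[W s, Z S; P] = 0 := by
      rw [covariance_eq_sub (memLp_two_mulVec hL2 A s) (hZ2 S), hWs0, zero_mul, sub_zero]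
      have hi : IndepFun (W s) g P := by
        refine (IndepFun_iff_Indep _ _ _).2 (indep_of_indep_of_le_left
          (indep_of_indep_of_le_right (hind S R hRS.symm) ?_) ?_)
        · exact measurable_iff_comap_le.1 hgm.measurable
        · exact measurable_iff_comap_le.1 (measurable_genBy W hs)
      have hWg : W s * Z S =ᵐ[P] W s * g := by
        filter_upwards [hSg] with ω hω
        simp [hω]
      rw [integral_congr_ae hWg, hi.integral_mul_eq_mul_integral
        (hWm s).aestronglyMeasurable hgi.aestronglyMeasurable, hWs0, zero_mul]
    -- By biorthogonality only the coefficient of X_s survives.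
    have hcovA : cov[W s, Z S; P] = A t s := by
      have hmem : ∀ j, MemLp (fun ω => (if j ∈ S then A t j else 0) * X j ω) 2 P :=
        fun j => (hL2 j).const_mul _
      have e : Z S = fun ω => ∑ j, (if j ∈ S then A t j else 0) * X j ω := by
        ext ω
        simp only [Z, ite_mul, zero_mul]
      rw [e, covariance_fun_sum_right hmem (memLp_two_mulVec hL2 A s)]
      simp only [covariance_const_mul_right, covariance_precision_mulVec hL2 hC]
      simp [hs]
    have hsymm := hA.isHermitian.apply s t
    simp only [star_trivial] at hsymm
    rw [← hsymm, ← hcovA, hcov0]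
  · intro hz s t hs ht
    have hind : Indep (genBy W S) (genBy X R ⊔ genBy X T) P := by
      refine indep_of_indep_of_le_right (indep_precision_mulVec hG hC S) ?_
      rw [hsup]
      refine genBy_le fun i hi => measurable_genBy X fun hiS => ?_
      rcases hi with hi | hi
      · exact Set.disjoint_left.1 hRS hi hiS
      · exact Set.disjoint_left.1 hST hiS hi
    exact condIndep_of_indep_sup (hleW S) (hle R) (hle T) hind
      (genBy_le_of_precision_eq_zero hA hcov hz _ hs) ht

end Gaussian

/-! ### The model as an invertible linear system. -/

section Model

variable {N d : ℕ} (m : Kind) (F : Fin (N + 1) → Fin (N + 1) → Matrix (Fin d) (Fin d) ℝ)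
  (G : Fin (N + 1) → Matrix (Fin d) (Fin d) ℝ)

lemma sum_ite_eq_mulVec (a : Fin (N + 1)) (M : Matrix (Fin d) (Fin d) ℝ)
    (v : Fin (N + 1) → Fin d → ℝ) : ∑ l, (if l = a then M else 0) *ᵥ v l = M *ᵥ v a := by
  rw [Finset.sum_eq_single a]
  · simp
  · intro b _ hb
    simp [hb]
  · simp

lemma calG_mulVec_eq_iff (x e : Fin (N + 1) → Fin d → ℝ) :
    m.calG F *ᵥ Function.uncurry x = Function.uncurry e ↔
      ∀ k, ∑ l, m.calGBlock F k l *ᵥ x l = e k := by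
  have h : ∀ k i, (m.calG F *ᵥ Function.uncurry x) (k, i) =
      (∑ l, m.calGBlock F k l *ᵥ x l) i := fun k i => by
    simp only [Matrix.mulVec, dotProduct, Fintype.sum_prod_type, Finset.sum_apply]
    rfl
  constructor
  · intro H k
    ext i
    rw [← h, H]
    rfl
  · intro H
    ext ⟨k, i⟩
    rw [h, H]
    rfl

/-- One formula for all three models. For c = N and k = N - 1 the successor and the conditioning
time coincide and their two contributions add up, whence the factor 2 in block (N-1, N). -/
lemma calGBlock_castSucc (k : Fin N) (hk : k.castSucc ≠ m.c N) (l : Fin (N + 1)) :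
    m.calGBlock F k.castSucc l = (if l = k.castSucc then 1 else 0)
      - (if l = k.succ then F k.castSucc k.succ else 0)
      - (if l = m.c N then F k.castSucc (m.c N) else 0) := by
  have h1 : k.castSucc ≠ Fin.last N := (Fin.castSucc_lt_last k).ne
  have h2 : k.succ ≠ k.castSucc := (Fin.castSucc_lt_succ).ne'
  have h3 : k.succ ≠ 0 := Fin.succ_ne_zero k
  have h4 : (l : ℕ) = k + 1 ↔ l = k.succ := by simp [Fin.ext_iff]
  unfold Kind.calGBlock
  by_cases hl : l = k.castSucc
  · subst hl
    simp [h2.symm, hk]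
  · rw [if_neg (Ne.symm hl), if_neg hl]
    cases m <;> simp only [Kind.c] at hk ⊢ <;> rw [if_neg (by assumption)]
    · simp only [if_neg h1, Fin.val_castSucc, h4]
      by_cases h0 : l = 0
      · subst h0
        simp [h3.symm]
      · by_cases hs : l = k.succ
        · subst hs; simp [h3]
        · simp [h0, hs]
    · simp only [if_neg h1, Fin.val_castSucc, h4]
      by_cases h0 : l = 0
      · subst h0
        simp [h3.symm]
      · by_cases hs : l = k.succ
        · subst hs; simp [h3]
        · simp [h0, hs]
    · simp only [Fin.val_castSucc, h4]
      by_cases h0 : l = Fin.last N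
      · subst h0
        by_cases hs : Fin.last N = k.succ
        · rw [← hs]; simp only [if_true, two_smul]; abel
        · simp [hs]
      · by_cases hs : l = k.succ
        · subst hs; simp [h0]
        · simp [h0, hs]

lemma sum_calGBlock_castSucc (k : Fin N) (hk : k.castSucc ≠ m.c N)
    (x : Fin (N + 1) → Fin d → ℝ) :
    ∑ l, m.calGBlock F k.castSucc l *ᵥ x l =
      x k.castSucc - F k.castSucc k.succ *ᵥ x k.succ - F k.castSucc (m.c N) *ᵥ x (m.c N) := by
  simp only [calGBlock_castSucc m F k hk, Matrix.sub_mulVec, Finset.sum_sub_distrib,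
    sum_ite_eq_mulVec, Matrix.one_mulVec]

/-- The rows not covered by the recursion are N and c. They are distinct for c = 0, because N ≥ 1,
and are the same row for c = N. -/
lemma sum_calGBlock_boundary (hN : 1 ≤ N) (x e : Fin (N + 1) → Fin d → ℝ) :
    (∑ l, m.calGBlock F (Fin.last N) l *ᵥ x l = e (Fin.last N) ∧
      ∑ l, m.calGBlock F (m.c N) l *ᵥ x l = e (m.c N)) ↔ m.Boundary F x e := by
  have h0 : (0 : Fin (N + 1)) ≠ Fin.last N := by
    simp only [ne_eq, Fin.ext_iff, Fin.val_zero, Fin.val_last]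
    omega
  have hid : ∀ k, (∀ l, m.calGBlock F k l = if l = k then 1 else 0) →
      ∑ l, m.calGBlock F k l *ᵥ x l = x k := fun k hk => by
    simp only [hk, sum_ite_eq_mulVec, Matrix.one_mulVec]
  have hsub : ∀ k c, (∀ l, m.calGBlock F k l = (if l = k then 1 else 0)
      - if l = c then F k c else 0) →
      ∑ l, m.calGBlock F k l *ᵥ x l = x k - F k c *ᵥ x c := fun k c hk => by
    simp only [hk, Matrix.sub_mulVec, Finset.sum_sub_distrib, sum_ite_eq_mulVec,
      Matrix.one_mulVec]
  cases m with
  | firstBC1 =>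
    rw [hid (Fin.last N) fun l => by
        simp only [Kind.calGBlock, h0.symm, if_true, if_false, eq_comm],
      hsub (Kind.c N .firstBC1) (Fin.last N) fun l => by
        rcases eq_or_ne l 0 with rfl | hl
        · simp [Kind.calGBlock, Kind.c, h0]
        · by_cases hl' : l = Fin.last N
          · simp [Kind.calGBlock, Kind.c, h0, h0.symm, hl']
          · simp [Kind.calGBlock, Kind.c, hl, hl.symm, hl']]
    simp only [Kind.Boundary, Kind.c, sub_eq_iff_eq_add']
  | firstBC2 =>
    rw [hid (Kind.c N .firstBC2) fun l => by
        
        by_cases h : l = 0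
        · simp [Kind.c, Kind.calGBlock, h]
        · simp [Kind.c, Kind.calGBlock, h, Ne.symm h],
      hsub (Fin.last N) 0 fun l => by
        rcases eq_or_ne l 0 with rfl | hl
        · simp [Kind.calGBlock, h0, h0.symm]
        · by_cases hl' : l = Fin.last N
          · simp [Kind.calGBlock, h0.symm, hl']
          · simp [Kind.calGBlock, hl, Ne.symm hl', hl', h0.symm]]
    simp only [Kind.Boundary, Kind.c, sub_eq_iff_eq_add']
    exact and_comm
  | last =>
    rw [hid (Fin.last N) fun l => by simp only [Kind.calGBlock, if_true, eq_comm],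
      hid (Kind.c N .last) fun l => by 
        by_cases h : l = Fin.last N
        · simp [Kind.c, Kind.calGBlock, h]
        · simp [Kind.c, Kind.calGBlock, h, Ne.symm h]]
    simp only [Kind.Boundary, Kind.c, and_self]

/-- The equations of the model are the linear system with matrix `𝒢`. -/
lemma calG_mulVec_eq_iff_model (hN : 1 ≤ N) (x e : Fin (N + 1) → Fin d → ℝ) :
    m.calG F *ᵥ Function.uncurry x = Function.uncurry e ↔
      (∀ k : Fin N, k.castSucc ≠ m.c N → x k.castSucc =
        F k.castSucc k.succ *ᵥ x k.succ + F k.castSucc (m.c N) *ᵥ x (m.c N) + e k.castSucc) ∧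
      m.Boundary F x e := by
  rw [calG_mulVec_eq_iff, ← sum_calGBlock_boundary m F hN]
  have hk : ∀ k : Fin N, k.castSucc ≠ m.c N →
      (∑ l, m.calGBlock F k.castSucc l *ᵥ x l = e k.castSucc ↔ x k.castSucc =
        F k.castSucc k.succ *ᵥ x k.succ + F k.castSucc (m.c N) *ᵥ x (m.c N) + e k.castSucc) :=
    fun k hk => by rw [sum_calGBlock_castSucc m F k hk, sub_sub, sub_eq_iff_eq_add']
  constructor
  · exact fun H => ⟨fun k h => (hk k h).1 (H _), H _, H _⟩
  · rintro ⟨H1, H2, H3⟩ k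
    by_cases hc : k = m.c N
    · exact hc ▸ H3
    · induction k using Fin.lastCases with
      | last => exact H2
      | cast k => exact (hk k hc).2 (H1 k hc)

/-- The kernel is trivial: with zero noise the boundary condition forces x_N = x_c = 0, and the
recursion carries this zero backward from N. -/
lemma isUnit_det_calG (hN : 1 ≤ N) : IsUnit (m.calG F).det := by
  rw [isUnit_iff_ne_zero]
  intro hdet
  obtain ⟨v, hv, hv0⟩ := Matrix.exists_mulVec_eq_zero_iff.2 hdet
  refine hv ?_
  obtain ⟨x, rfl⟩ : ∃ x : Fin (N + 1) → Fin d → ℝ, Function.uncurry x = v :=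
    ⟨Function.curry v, Function.uncurry_curry v⟩
  obtain ⟨H, hb⟩ := (calG_mulVec_eq_iff_model m F hN x 0).1 hv0
  have hx : x (Fin.last N) = 0 ∧ x (m.c N) = 0 := by
    cases m with
    | firstBC1 =>
      obtain ⟨h1, h2⟩ := hb
      simp only [Pi.zero_apply] at h1
      exact ⟨h1, by simpa [h1, Kind.c] using h2⟩
    | firstBC2 =>
      obtain ⟨h1, h2⟩ := hb
      simp only [Pi.zero_apply] at h1
      exact ⟨by simpa [h1] using h2, h1⟩
    | last => exact ⟨hb, hb⟩
  have hx0 : ∀ k, x k = 0 := fun k => by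
    induction k using Fin.reverseInduction with
    | last => exact hx.1
    | cast k ih =>
      by_cases hc : k.castSucc = m.c N
      · rw [hc, hx.2]
      · rw [H k hc, ih, hx.2]
        simp
  ext ⟨k, i⟩
  simp [Function.uncurry, hx0]

variable {G} in
lemma posDef_diagG (hG : ∀ k, (G k).PosDef) : (diagG G).PosDef := by
  refine Matrix.PosDef.of_dotProduct_mulVec_pos ?_ fun {x} hx => ?_
  · ext ⟨k, i⟩ ⟨l, j⟩
    by_cases h : k = l
    · subst h
      simpa [diagG] using (hG k).isHermitian.apply i j
    · simp [diagG, h, Ne.symm h]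
  · have e : star x ⬝ᵥ (diagG G *ᵥ x) =
        ∑ k, star (Function.curry x k) ⬝ᵥ (G k *ᵥ Function.curry x k) := by
      simp only [dotProduct, Matrix.mulVec, Fintype.sum_prod_type, diagG, Matrix.of_apply]
      refine Finset.sum_congr rfl fun k _ => Finset.sum_congr rfl fun i _ => ?_
      rw [Finset.sum_eq_single k]
      · simp [Function.curry]
      · intro l _ hl
        simp [Ne.symm hl]
      · simp
    rw [e]
    obtain ⟨⟨k, i⟩, hki⟩ := Function.ne_iff.1 hx
    refine Finset.sum_pos' (fun l _ => (hG l).posSemidef.dotProduct_mulVec_nonneg _)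
      ⟨k, Finset.mem_univ k, (hG k).dotProduct_mulVec_pos fun h => hki ?_⟩
    exact congrFun h i

variable {G} in
lemma posDef_A (hN : 1 ≤ N) (hG : ∀ k, (G k).PosDef) : (m.A F G).PosDef := by
  have h := (posDef_diagG hG).inv.conjTranspose_mul_mul_same (B := m.calG F)
    (Matrix.mulVec_injective_iff_isUnit.2
      ((Matrix.isUnit_iff_isUnit_det _).2 (isUnit_det_calG m F hN)))
  simpa [Kind.A, Matrix.conjTranspose_eq_transpose_of_trivial] using h

end Model

/-! ### Law of governed sequences, the reciprocal and Markov criteria, and existence. -/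

section Governed

variable {N d : ℕ} {Ω : Type*}

/-- The components of a sequence as a single family of real random variables. -/
def components (x : Sequence N d Ω) : Fin (N + 1) × Fin d → Ω → ℝ := fun p ω => x p.1 ω p.2

lemma sigmaOf_eq_genBy (x : Sequence N d Ω) (S : Set (Fin (N + 1))) :
    sigmaOf x S = genBy (components x) {p | p.1 ∈ S} := by
  apply le_antisymm
  · refine iSup₂_le fun k hk => ?_
    exact measurable_iff_comap_le.1 (@measurable_pi_iff _ _ _ (genBy (components x) _) _ _ |>.2
      fun i => measurable_genBy (components x) (S := {p | p.1 ∈ S}) (i := (k, i)) hk)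
  · refine genBy_le fun p hp => ?_
    have h : Measurable[sigmaOf x S] (x p.1) :=
      measurable_iff_comap_le.2 (le_iSup₂_of_le p.1 hp le_rfl)
    exact @Measurable.comp _ _ _ (sigmaOf x S) _ _ _ _ (measurable_pi_apply p.2) h

variable [MeasurableSpace Ω] {P : Measure Ω}

lemma covariance_congr_ae {X X' Y Y' : Ω → ℝ} (hX : X =ᵐ[P] X') (hY : Y =ᵐ[P] Y') :
    cov[X, Y; P] = cov[X', Y'; P] := by
  rw [covariance, covariance, integral_congr_ae hX, integral_congr_ae hY]
  refine integral_congr_ae ?_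
  filter_upwards [hX, hY] with ω h h'
  rw [h, h']

lemma hasGaussianLaw_components {x : Sequence N d Ω} (hx : IsGaussianProcess x P) :
    HasGaussianLaw (fun ω p => components x p ω) P := by
  let L : ({k // k ∈ Finset.univ (α := Fin (N + 1))} → Fin d → ℝ) →L[ℝ] (Fin (N + 1) × Fin d → ℝ) :=
    LinearMap.toContinuousLinearMap
      { toFun := fun v p => v ⟨p.1, Finset.mem_univ _⟩ p.2
        map_add' := fun _ _ => rfl
        map_smul' := fun _ _ => rfl }
  exact (hx.hasGaussianLaw Finset.univ).map L

lemma isGaussianProcess_of_hasGaussianLaw_components {x : Sequence N d Ω}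
    (hx : HasGaussianLaw (fun ω p => components x p ω) P) : IsGaussianProcess x P where
  hasGaussianLaw I := by
    let L : (Fin (N + 1) × Fin d → ℝ) →L[ℝ] (I → Fin d → ℝ) :=
      LinearMap.toContinuousLinearMap
        { toFun := fun v k i => v (k, i)
          map_add' := fun _ _ => rfl
          map_smul' := fun _ _ => rfl }
    exact hx.map L

variable {m : Kind} {F : Fin (N + 1) → Fin (N + 1) → Matrix (Fin d) (Fin d) ℝ}
  {G : Fin (N + 1) → Matrix (Fin d) (Fin d) ℝ}

lemma isGovernedBy_iff (hN : 1 ≤ N) (x : Sequence N d Ω) :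
    IsGovernedBy m F G x P ↔ ∃ e : Sequence N d Ω, IsWhiteGaussian e G P ∧
      ∀ᵐ ω ∂P, m.calG F *ᵥ (fun p => components x p ω) = fun p => components e p ω :=
  exists_congr fun e => and_congr_right fun _ => Filter.eventually_congr <|
    Filter.Eventually.of_forall fun ω =>
      (calG_mulVec_eq_iff_model m F hN (fun k => x k ω) (fun k => e k ω)).symm

lemma IsGovernedBy.law (hN : 1 ≤ N) (hG : ∀ k, (G k).PosDef) {x : Sequence N d Ω}
    (hx : IsGovernedBy m F G x P) :
    HasGaussianLaw (fun ω p => components x p ω) P ∧ (∀ p, ∫ ω, components x p ω ∂P = 0) ∧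
      m.A F G * covMatrix x P = 1 := by
  obtain ⟨e, he, hxe⟩ := (isGovernedBy_iff hN x).1 hx
  have heG := hasGaussianLaw_components he.gaussian
  have := heG.isProbabilityMeasure
  have hu := isUnit_det_calG m F hN
  set B := (m.calG F)⁻¹ with hB
  have hxB : ∀ᵐ ω ∂P, (fun p => components x p ω) = B *ᵥ fun p => components e p ω := by
    filter_upwards [hxe] with ω hω
    rw [← hω, Matrix.mulVec_mulVec, Matrix.nonsing_inv_mul _ hu, Matrix.one_mulVec]
  have hxp : ∀ p, components x p =ᵐ[P] fun ω => (B *ᵥ fun p => components e p ω) p := fun p => by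
    filter_upwards [hxB] with ω hω using congrFun hω p
  have heL := memLp_two_of_hasGaussianLaw heG
  refine ⟨?_, fun p => ?_, ?_⟩
  · exact (heG.map (LinearMap.toContinuousLinearMap B.mulVecLin)).congr
      (hxB.mono fun ω h => h.symm)
  · rw [integral_congr_ae (hxp p)]
    exact integral_mulVec_eq_zero (fun p => (heL p).integrable one_le_two)
      (fun p => he.mean_zero p.1 p.2) B p
  · have hD : Matrix.of (fun p q => cov[components e p, components e q; P]) = diagG G := by
      ext p q
      exact he.cov_eq p.1 q.1 p.2 q.2
    have hC : covMatrix x P = B * diagG G * Bᵀ := by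
      ext p q
      rw [← hD, ← covariance_mulVec_mulVec heL]
      exact covariance_congr_ae (hxp p) (hxp q)
    have hD' : IsUnit (diagG G).det := (Matrix.isUnit_iff_isUnit_det _).1 (posDef_diagG hG).isUnit
    calc m.A F G * covMatrix x P
        = (m.calG F)ᵀ * ((diagG G)⁻¹ * (m.calG F * B) * diagG G) * Bᵀ := by
          simp only [Kind.A, hC, Matrix.mul_assoc]
      _ = 1 := by
          rw [Matrix.mul_nonsing_inv _ hu, Matrix.mul_one, Matrix.nonsing_inv_mul _ hD',
            Matrix.mul_one, ← Matrix.transpose_mul, Matrix.nonsing_inv_mul _ hu,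
            Matrix.transpose_one]

lemma IsGovernedBy.isZMNG (hN : 1 ≤ N) (hG : ∀ k, (G k).PosDef) {x : Sequence N d Ω}
    (hx : IsGovernedBy m F G x P) : IsZMNG x P := by
  obtain ⟨h1, h2, h3⟩ := hx.law hN hG
  exact ⟨isGaussianProcess_of_hasGaussianLaw_components h1, fun k i => h2 (k, i),
    (Matrix.isUnit_det_of_left_inverse h3).ne_zero⟩

/-- The scalar criterion applied to A, each time k being replaced by its d components. -/
lemma IsGovernedBy.condIndepGiven_iff (hN : 1 ≤ N) (hG : ∀ k, (G k).PosDef) {x : Sequence N d Ω}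
    (hxm : ∀ k, Measurable (x k)) (hx : IsGovernedBy m F G x P) {R S T : Set (Fin (N + 1))}
    (hcov : R ∪ S ∪ T = Set.univ) (hRS : Disjoint R S) (hRT : Disjoint R T)
    (hST : Disjoint S T) :
    CondIndepGiven x P R S T ↔ ∀ k ∈ S, ∀ l ∈ T, ∀ i j, m.A F G (k, i) (l, j) = 0 := by
  obtain ⟨h1, h2, h3⟩ := hx.law hN hG
  have hpre : ∀ {U V : Set (Fin (N + 1))}, Disjoint U V →
      Disjoint {p : Fin (N + 1) × Fin d | p.1 ∈ U} {p | p.1 ∈ V} :=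
    fun h => h.preimage Prod.fst
  unfold CondIndepGiven
  rw [sigmaOf_eq_genBy x R, sigmaOf_eq_genBy x S, sigmaOf_eq_genBy x T]
  refine (condIndep_iff_precision_eq_zero (X := components x)
    (fun p => (measurable_pi_apply p.2).comp (hxm p.1)) h1 h2 h3 (posDef_A m F hN hG) ?_ (hpre hRS) (hpre hRT) (hpre hST)).trans ?_
  · ext p
    simpa using (Set.ext_iff.1 hcov p.1)
  · exact ⟨fun H k hk l hl i j => H (k, i) hk (l, j) hl,
      fun H p hp q hq => H p.1 hp q.1 hq p.2 q.2⟩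

lemma A_symm (hN : 1 ≤ N) (hG : ∀ k, (G k).PosDef) (p q : Fin (N + 1) × Fin d) :
    m.A F G p q = m.A F G q p := by
  simpa using (posDef_A m F hN hG).isHermitian.apply q p

lemma IsGovernedBy.isReciprocal_iff (hN : 1 ≤ N) (hG : ∀ k, (G k).PosDef) {x : Sequence N d Ω}
    (hxm : ∀ k, Measurable (x k)) (hx : IsGovernedBy m F G x P) :
    IsReciprocal x P ↔ IsCyclicTridiagonal (m.A F G) := by
  have key : ∀ k₁ k₂ : Fin (N + 1), k₁ < k₂ →
      (CondIndepGiven x P {k₁, k₂} {k | k₁ < k ∧ k < k₂} {k | k < k₁ ∨ k₂ < k} ↔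
        ∀ k, k₁ < k ∧ k < k₂ → ∀ l, l < k₁ ∨ k₂ < l → ∀ i j, m.A F G (k, i) (l, j) = 0) :=
    fun k₁ k₂ h => by
      refine hx.condIndepGiven_iff hN hG hxm ?_ ?_ ?_ ?_
      · ext k
        simp only [Set.mem_union, Set.mem_insert_iff, Set.mem_singleton_iff, Set.mem_ofPred_eq,
          Set.mem_univ, iff_true]
        omega
      all_goals
        rw [Set.disjoint_left]
        intro k
        simp only [Set.mem_insert_iff, Set.mem_singleton_iff, Set.mem_ofPred_eq]
        omega
  constructor
  · intro H k l hkl hc i j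
    suffices h : m.A F G (k, i) (l, j) = 0 from ⟨h, by rw [A_symm hN hG, h]⟩
    have hl := l.is_le
    -- An interval must contain one of k, l strictly inside and leave the other strictly outside. If
    -- l = N, then k ≠ 0 and (0, l - 1) works; otherwise (k + 1, N) does, with l inside.
    by_cases hlN : (l : ℕ) = N
    · have hk0 : (k : ℕ) ≠ 0 := fun h0 => hc ⟨Fin.ext h0, Fin.ext hlN⟩
      have h01 : (⟨0, by omega⟩ : Fin (N + 1)) < ⟨l - 1, by omega⟩ := by
        rw [Fin.mk_lt_mk]; omega
      refine (key _ _ h01).1 (H _ _ h01) k ⟨?_, ?_⟩ l (Or.inr ?_) i j <;>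
        rw [Fin.lt_def] <;> dsimp only <;> omega
    · have h01 : (⟨k + 1, by omega⟩ : Fin (N + 1)) < ⟨N, by omega⟩ := by
        rw [Fin.mk_lt_mk]; omega
      rw [A_symm hN hG]
      refine (key _ _ h01).1 (H _ _ h01) l ⟨?_, ?_⟩ k (Or.inl ?_) j i <;>
        rw [Fin.lt_def] <;> dsimp only <;> omega
  · intro H k₁ k₂ h
    -- An endpoint lies strictly between k and l, so they differ by more than 1; k is interior,
    -- hence neither 0 nor N, so the block is not a corner.
    refine (key k₁ k₂ h).2 fun k hk l hl i j => ?_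
    have hk1 : (k₁ : ℕ) < k := hk.1
    have hk2 : (k : ℕ) < k₂ := hk.2
    have := k₂.is_le
    rcases hl with hl | hl
    · have hl' : (l : ℕ) < k₁ := hl
      refine (H l k (by omega) (fun h => ?_) j i).2
      have := congrArg Fin.val h.2
      rw [Fin.val_last] at this
      omega
    · have hl' : (k₂ : ℕ) < l := hl
      refine (H k l (by omega) (fun h => ?_) i j).1
      have := congrArg Fin.val h.1
      rw [Fin.val_zero] at this
      omega

lemma IsGovernedBy.isMarkov_iff (hN : 1 ≤ N) (hG : ∀ k, (G k).PosDef) {x : Sequence N d Ω}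
    (hxm : ∀ k, Measurable (x k)) (hx : IsGovernedBy m F G x P) :
    IsMarkov x P ↔ IsTridiagonal (m.A F G) := by
  have key : ∀ k : Fin (N + 1), (CondIndepGiven x P {k} {i | i < k} {i | k < i} ↔
        ∀ l, l < k → ∀ r, k < r → ∀ i j, m.A F G (l, i) (r, j) = 0) :=
    fun k => by
      refine hx.condIndepGiven_iff hN hG hxm ?_ ?_ ?_ ?_
      · ext l
        simp only [Set.mem_union, Set.mem_singleton_iff, Set.mem_ofPred_eq, Set.mem_univ, iff_true]
        omega
      all_goals
        rw [Set.disjoint_left]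
        intro k
        simp only [Set.mem_singleton_iff, Set.mem_ofPred_eq]
        omega
  constructor
  · intro H k l hkl i j
    -- Since k + 1 < l, time k + 1 separates k from l.
    have h := (key ⟨k + 1, by omega⟩).1 (H _) k (by rw [Fin.lt_def]; dsimp only; omega) l
      (by rw [Fin.lt_def]; dsimp only; omega) i j
    exact ⟨h, by rw [A_symm hN hG, h]⟩
  · intro H k
    refine (key k).2 fun l hl r hr i j => (H l r ?_ i j).1
    have hl' : (l : ℕ) < k := hl
    have hr' : (k : ℕ) < r := hr
    omega

variable (m F) in
lemma exists_isGovernedBy (hN : 1 ≤ N) (hG : ∀ k, (G k).PosDef) :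
    ∃ (Ω : Type) (_ : MeasurableSpace Ω) (P : Measure Ω) (x : Sequence N d Ω),
      IsProbabilityMeasure P ∧ (∀ k, Measurable (x k)) ∧ IsGovernedBy m F G x P := by
  -- The noise is the coordinate process of a Gaussian measure with covariance diag(G), and x solves
  -- the system pointwise.
  set P := multivariateGaussian (0 : EuclideanSpace ℝ (Fin (N + 1) × Fin d)) (diagG G) with hP
  have hD := (posDef_diagG hG).posSemidef
  let e : Sequence N d (EuclideanSpace ℝ (Fin (N + 1) × Fin d)) := fun k ω i => ω (k, i)
  let x : Sequence N d (EuclideanSpace ℝ (Fin (N + 1) × Fin d)) :=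
    fun k ω i => ((m.calG F)⁻¹ *ᵥ fun p => components e p ω) (k, i)
  have hem : ∀ p, Measurable (components e p) := fun p => by
    change Measurable fun ω : EuclideanSpace ℝ (Fin (N + 1) × Fin d) => ω (p.1, p.2)
    fun_prop
  refine ⟨_, inferInstance, P, x, inferInstance, fun k => ?_, ?_⟩
  · exact measurable_pi_iff.2 fun i => measurable_mulVec hem _ _
  · refine (isGovernedBy_iff hN x).2 ⟨e, ⟨?_, fun k i => ?_, fun k l i j => ?_⟩, ?_⟩
    · apply isGaussianProcess_of_hasGaussianLaw_components
      have h : HasGaussianLaw id P := IsGaussian.hasGaussianLaw_id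
      exact h.map (EuclideanSpace.equiv (Fin (N + 1) × Fin d) ℝ).toContinuousLinearMap
    · have h := (EuclideanSpace.proj (𝕜 := ℝ) (k, i)).integral_comp_id_comm (μ := P) IsGaussian.integrable_id
      rw [integral_id_multivariateGaussian] at h
      simpa using h
    · exact covariance_eval_multivariateGaussian hD (k, i) (l, j)
    · refine Filter.Eventually.of_forall fun ω => ?_
      change m.calG F *ᵥ ((m.calG F)⁻¹ *ᵥ fun p => components e p ω) = _
      rw [Matrix.mulVec_mulVec, Matrix.mul_nonsing_inv _ (isUnit_det_calG m F hN),
        Matrix.one_mulVec]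

end Governed

end BackwardCM

theorem mainTheorem6 {N d : ℕ} (hN : 1 ≤ N) (m : BackwardCM.Kind)
    (F : Fin (N + 1) → Fin (N + 1) → Matrix (Fin d) (Fin d) ℝ)
    (G : Fin (N + 1) → Matrix (Fin d) (Fin d) ℝ) (hG : ∀ k, (G k).PosDef) :
    (∃ (Ω : Type) (_ : MeasurableSpace Ω) (P : Measure Ω) (x : BackwardCM.Sequence N d Ω),
      IsProbabilityMeasure P ∧ (∀ k, Measurable (x k)) ∧ BackwardCM.IsGovernedBy m F G x P) ∧
    ∀ (Ω : Type*) [MeasurableSpace Ω] (P : Measure Ω) [IsProbabilityMeasure P]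
      (x : BackwardCM.Sequence N d Ω), (∀ k, Measurable (x k)) →
      BackwardCM.IsGovernedBy m F G x P →
        BackwardCM.IsZMNG x P ∧
        (BackwardCM.IsReciprocal x P ↔ BackwardCM.IsCyclicTridiagonal (m.A F G)) ∧
        (BackwardCM.IsMarkov x P ↔ BackwardCM.IsTridiagonal (m.A F G)) :=
  ⟨BackwardCM.exists_isGovernedBy m F hN hG, fun _ _ _ _ _ hxm hx =>
    ⟨hx.isZMNG hN hG, hx.isReciprocal_iff hN hG hxm, hx.isMarkov_iff hN hG hxm⟩⟩
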